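/- All subcategories below are full, and a full subcategory $\mathbf K$ of the category $\mathbf{Top}_0$ of $T_0$ spaces and continuous maps is identified with its class of objects, called $\mathbf K$-spaces. **Definitions.** A $T_0$ space is *sober* if every (nonempty) irreducible closed set is the closure of a unique point; it is *well-filtered* if for every nonempty filtered family $\mathcal K$ of nonempty compact saturated sets and every open $U$ with $\bigcap\mathcal K\subseteq U$ there is $K\in\mathcal K$ with $K\subseteq U$ (saturated means: equal to the intersection of its open neighbourhoods). Let $\mathbf{Sob}$ and $\mathbf{Top}_w$ be the full subcategories of $\mathbf{Top}_0$ of sober and of well-filtered spaces. For a $T_0$ space $X$, a subset $A\subseteq X$ is a *$\mathbf K$-set* if for every continuous $f:X\to Y$ into a $\mathbf K$-space $Y$ there is a unique $y\in Y$ with $\overline{f(A)}=\overline{\{y\}}$; $\mathbf K(X)$ is the set of closed $\mathbf K$-sets of $X$, and $P_H(\mathbf K(X))$ is $\mathbf K(X)$ with the topology having as subbase the sets $\{A\in\mathbf K(X): A\cap U\neq\emptyset\}$, $U\subseteq X$ open. $\mathbf K$ is *adequate* if $P_H(\mathbf K(X))$ is a $\mathbf K$-space for every $T_0$ space $X$.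 A *$\mathbf K$-reflection* of $X$ is a $\mathbf K$-space $X^k$ with a continuous map $\eta:X\to X^k$ such that every continuous map $f$ from $X$ to a $\mathbf K$-space factors as $f=f^*\circ\eta$ for a unique continuous $f^*$; it is unique up to homeomorphism. The sobrification and the well-filtered reflection are the $\mathbf{Sob}$- and the $\mathbf{Top}_w$-reflection. The *Scott space* $\Sigma P$ of a poset $P$ is $P$ with the Scott topology, whose open sets are the upper sets $U$ such that every directed (nonempty) set $D$ with an existing supremum in $U$ meets $U$; a space is a Scott space if it is homeomorphic to $\Sigma P$ for some poset $P$. Let $\mathbb J=\mathbb N\times(\mathbb N\cup\{\omega\})$ with $(j,k)\le(m,n)$ iff $j=m$ and $k\le n$, or $n=\omega$ and $k\le m$; $\Sigma\mathbb J$ is the *Johnstone space*. **Proposition.** Let $\mathbf K$ be a full subcategory of $\mathbf{Top}_w$ that contains $\mathbf{Sob}$, is closed under homeomorphisms and is adequate. Then the $\mathbf K$-reflection of the Johnstone space $\Sigma\mathbb J$ exists and is not a Scott space. In particular, the sobrification and the well-filtered reflection of $\Sigma\mathbb J$ exist, and neither of them is a Scott space. -/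

import Mathlib

open CategoryTheory

universe u

namespace KRefl

/-! ### Sober and well-filtered spaces -/

/-- Sober spaces: every irreducible closed set is the closure of a unique point, that is,
`T₀` together with existence of generic points. (A full subcategory of the category of
topological spaces is given by its class of objects.) -/
def Sob : ObjectProperty TopCat.{u} := fun X => T0Space X ∧ QuasiSober X

/-- A set is saturated if it is the intersection of all open sets containing it. -/
def IsSaturated {X : Type u} [TopologicalSpace X] (A : Set X) : Prop :=
  A = ⋂₀ {U : Set X | IsOpen U ∧ A ⊆ U}

/-- Well-filteredness: for every filtered family `𝒦` of nonempty compact saturated sets and every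
open `U` with `⋂ 𝒦 ⊆ U`, some member of `𝒦` is contained in `U`.  (Filtered families are nonempty.)
-/
def IsWellFiltered (X : Type u) [TopologicalSpace X] : Prop :=
  ∀ 𝒦 : Set (Set X), 𝒦.Nonempty → (∀ A ∈ 𝒦, A.Nonempty ∧ IsCompact A ∧ IsSaturated A) →
    DirectedOn (fun A B => B ⊆ A) 𝒦 →
    ∀ U : Set X, IsOpen U → ⋂₀ 𝒦 ⊆ U → ∃ A ∈ 𝒦, A ⊆ U

/-- The full subcategory of well-filtered `T₀` spaces. -/
def TopW : ObjectProperty TopCat.{u} := fun X => T0Space X ∧ IsWellFiltered X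

/-! ### `K`-sets, adequacy and `K`-reflections -/

/-- `A` is a `K`-set of `X`: for every continuous `f : X → Y` into a `K`-space there is a unique
point `y` of `Y` with `closure (f '' A) = closure {y}`. -/
def IsKSet (K : ObjectProperty TopCat.{u}) (X : TopCat.{u}) (A : Set X) : Prop :=
  ∀ Y : TopCat.{u}, K Y → ∀ f : C(X, Y), ∃! y : Y, closure (f '' A) = closure {y}

/-- The collection of all closed `K`-sets of `X`. -/
def closedKSets (K : ObjectProperty TopCat.{u}) (X : TopCat.{u}) : Set (Set X) :=
  {A | IsClosed A ∧ IsKSet K X A}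

/-- The collection `𝒢` of subsets of `X`, as the underlying type of the space `P_H(𝒢)`. -/
def LowerVietoris {X : Type u} (𝒢 : Set (Set X)) : Type u := 𝒢

/-- The lower Vietoris topology on `𝒢`: the sets `◇U = {G ∈ 𝒢 | G ∩ U ≠ ∅}`, `U` open in `X`, are a
subbase. -/
instance {X : Type u} [TopologicalSpace X] (𝒢 : Set (Set X)) :
    TopologicalSpace (LowerVietoris 𝒢) :=
  TopologicalSpace.generateFrom
    {V | ∃ U : Set X, IsOpen U ∧ V = {G : 𝒢 | ((G : Set X) ∩ U).Nonempty}}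

/-- `K` is adequate: for every `T₀` space `X`, the space of closed `K`-sets of `X` with the lower
Vietoris topology is a `K`-space. -/
def IsAdequate (K : ObjectProperty TopCat.{u}) : Prop :=
  ∀ X : TopCat.{u}, T0Space X → K (TopCat.of (LowerVietoris (closedKSets K X)))

/-- `⟨R, η⟩` is a `K`-reflection of `X`. -/
structure IsReflection (K : ObjectProperty TopCat.{u}) (X R : TopCat.{u}) (η : C(X, R)) :
    Prop where
  mem : K R
  existsUnique_lift : ∀ Y : TopCat.{u}, K Y → ∀ f : C(X, Y), ∃! g : C(R, Y), g.comp η = f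

/-! ### Scott spaces and the Johnstone space -/

/-- `X` is (homeomorphic to) the Scott space of a poset. -/
def IsScottSpace (X : TopCat.{u}) : Prop :=
  ∃ (P : Type u) (_ : PartialOrder P), Nonempty (X ≃ₜ Topology.WithScott P)

/-- The underlying set `ℕ × (ℕ ∪ {ω})` of the Johnstone dcpo. -/
@[ext]
structure Johnstone where
  fst : ℕ
  snd : WithTop ℕ

/-- `(j, k) ≤ (m, n)` iff `j = m` and `k ≤ n`, or `n = ω` and `k ≤ m`. -/
instance : PartialOrder Johnstone where
  le x y := (x.fst = y.fst ∧ x.snd ≤ y.snd) ∨ (y.snd = ⊤ ∧ x.snd ≤ (y.fst : WithTop ℕ))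
  le_refl x := Or.inl ⟨rfl, le_rfl⟩
  le_trans x y z := by
    rintro (⟨h1, h2⟩ | ⟨h1, h2⟩) (⟨h3, h4⟩ | ⟨h3, h4⟩)
    · exact Or.inl ⟨h1.trans h3, h2.trans h4⟩
    · exact Or.inr ⟨h3, h2.trans h4⟩
    · exact Or.inr ⟨top_le_iff.1 (h1 ▸ h4), h3 ▸ h2⟩
    · exact absurd (top_le_iff.1 (h1 ▸ h4)) (WithTop.coe_ne_top)
  le_antisymm x y := by
    rintro (⟨h1, h2⟩ | ⟨h1, h2⟩) (⟨h3, h4⟩ | ⟨h3, h4⟩)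
    · exact Johnstone.ext h1 (le_antisymm h2 h4)
    · have hy : y.snd = ⊤ := top_le_iff.1 (h3 ▸ h2)
      exact absurd (top_le_iff.1 (hy ▸ h4)) (WithTop.coe_ne_top)
    · have hx : x.snd = ⊤ := top_le_iff.1 (h1 ▸ h4)
      exact absurd (top_le_iff.1 (hx ▸ h2)) (WithTop.coe_ne_top)
    · exact absurd (top_le_iff.1 (h1 ▸ h4)) (WithTop.coe_ne_top)

/-- The Johnstone space, the Scott space of the Johnstone dcpo (placed in any universe). -/
def johnstoneSpace : TopCat.{u} := TopCat.of (Topology.WithScott (ULift.{u} Johnstone))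

/-- The `K`-reflection of `X` exists and is not a Scott space.  (Reflections are unique up to
homeomorphism, so this does not depend on the choice of the reflection.) -/
def ReflectionNotScott (K : ObjectProperty TopCat.{u}) (X : TopCat.{u}) : Prop :=
  (∃ (R : TopCat.{u}) (η : C(X, R)), IsReflection K X R η) ∧
    ∀ (R : TopCat.{u}) (η : C(X, R)), IsReflection K X R η → ¬ IsScottSpace R

end KRefl

open KRefl

/-! A nonempty open subset of ΣJ contains almost all maximal points `(m, ω)`. Hence ΣJ is
irreducible. It has no generic point, while every proper irreducible closed subset has one
(`johnstone_irreducible_closed`). Adding a single generic point therefore gives a sober space.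

This space is the `K`-reflection for every `K` between `Sob` and `TopW`: the tails of the sequence
of maximal points are compact, so well-filteredness of `Y` gives the closure of the range of any
continuous map ΣJ → `Y` a generic point (`exists_closure_range_eq`), to which the new point must be
sent.

The extension is not a Scott space. In its order the new point is a top element above J, and J is a
dcpo, so no directed subset of J has the new point as supremum. In a Scott topology the new point
would thus be open, but every open set containing it meets J. -/

namespace KRefl

open Set Topology Topology.WithScott

/-! ### Sober spaces are well-filtered -/

lemma IsSaturated.mem_of_specializes {X : Type u} [TopologicalSpace X] {A : Set X}
    (hA : IsSaturated A) {x y : X} (h : x ⤳ y) (hy : y ∈ A) : x ∈ A := by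
  rw [hA]
  rintro U ⟨hU, hAU⟩
  exact h.mem_open hU (hAU hy)

/-- By Zorn and compactness, a counterexample yields a minimal closed set outside `U` meeting every
member of `𝒦`. Minimality and filteredness make it irreducible; saturation puts its generic point in
every member, hence in `U`. -/
lemma isWellFiltered_of_quasiSober (X : Type u) [TopologicalSpace X] [QuasiSober X] :
    IsWellFiltered X := by
  intro 𝒦 h𝒦 hK hdir U hU hsub
  by_contra! hcon
  let S : Set (Set X) := {C | IsClosed C ∧ C ⊆ Uᶜ ∧ ∀ A ∈ 𝒦, (A ∩ C).Nonempty}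
  obtain ⟨C, -, ⟨hC, hCU, hCK⟩, hmin⟩ : ∃ m, m ⊆ Uᶜ ∧ Minimal (· ∈ S) m := by
    refine zorn_superset_nonempty S ?_ _ ⟨hU.isClosed_compl, Subset.rfl, fun A hA => ?_⟩
    · intro c hc hchain hne
      have := hne.to_subtype
      refine ⟨⋂₀ c, ⟨isClosed_sInter fun s hs => (hc hs).1, ?_, fun A hA => ?_⟩,
        fun s hs => sInter_subset_of_mem hs⟩
      · obtain ⟨s, hs⟩ := hne
        exact (sInter_subset_of_mem hs).trans (hc hs).2.1
      · by_contra hem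
        rw [not_nonempty_iff_eq_empty, sInter_eq_iInter] at hem
        obtain ⟨s, hs⟩ := (hK A hA).2.1.elim_directed_family_closed (fun s : c => (s : Set X))
          (fun s => (hc s.2).1) hem (by
            intro s t
            rcases hchain.total s.2 t.2 with h | h
            · exact ⟨s, Subset.rfl, h⟩
            · exact ⟨t, h, Subset.rfl⟩)
        exact ((hc s.2).2.2 A hA).ne_empty hs
    · exact not_subset.1 (hcon A hA)
  have hirr : IsIrreducible C := by
    refine ⟨?_, isPreirreducible_iff_isClosed_union_isClosed.2 fun C₁ C₂ h₁ h₂ hCC => ?_⟩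
    · obtain ⟨A, hA⟩ := h𝒦
      exact (hCK A hA).mono inter_subset_right
    · by_contra! hn
      have key : ∀ Z : Set X, IsClosed Z → ¬ C ⊆ Z → ∃ A ∈ 𝒦, A ∩ (C ∩ Z) = ∅ := by
        intro Z hZ hCZ
        by_contra! h
        exact hCZ ((hmin ⟨hC.inter hZ, inter_subset_left.trans hCU, h⟩
          inter_subset_left).trans inter_subset_right)
      obtain ⟨A₁, hA₁, e₁⟩ := key C₁ h₁ hn.1
      obtain ⟨A₂, hA₂, e₂⟩ := key C₂ h₂ hn.2
      obtain ⟨A, hA, s₁, s₂⟩ := hdir A₁ hA₁ A₂ hA₂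
      obtain ⟨x, hxA, hxC⟩ := hCK A hA
      rcases hCC hxC with hx | hx
      · exact eq_empty_iff_forall_notMem.1 e₁ x ⟨s₁ hxA, hxC, hx⟩
      · exact eq_empty_iff_forall_notMem.1 e₂ x ⟨s₂ hxA, hxC, hx⟩
  obtain ⟨x, hx⟩ := QuasiSober.sober hirr hC
  refine hCU hx.mem (hsub fun A hA => ?_)
  obtain ⟨y, hyA, hyC⟩ := hCK A hA
  exact (hK A hA).2.2.mem_of_specializes (hx.specializes hyC) hyA

lemma sob_le_topW : Sob.{u} ≤ TopW := fun X ⟨h₀, _⟩ => ⟨h₀, isWellFiltered_of_quasiSober X⟩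

/-! ### Uniqueness of reflections -/

lemma IsReflection.nonempty_homeomorph {K : ObjectProperty TopCat.{u}} {X R S : TopCat.{u}}
    {η : C(X, R)} {θ : C(X, S)} (hR : IsReflection K X R η) (hS : IsReflection K X S θ) :
    Nonempty (R ≃ₜ S) := by
  obtain ⟨f, hf, -⟩ := hR.existsUnique_lift S hS.mem θ
  obtain ⟨g, hg, -⟩ := hS.existsUnique_lift R hR.mem η
  have h₁ : g.comp f = ContinuousMap.id R :=
    (hR.existsUnique_lift R hR.mem η).unique
      (by rw [ContinuousMap.comp_assoc, hf, hg]) (ContinuousMap.id_comp η)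
  have h₂ : f.comp g = ContinuousMap.id S :=
    (hS.existsUnique_lift S hS.mem θ).unique
      (by rw [ContinuousMap.comp_assoc, hg, hf]) (ContinuousMap.id_comp θ)
  exact ⟨{ toFun := f, invFun := g, left_inv := DFunLike.congr_fun h₁,
           right_inv := DFunLike.congr_fun h₂ }⟩

/-! ### Adding a generic point to an irreducible space -/

/-- The space obtained from `X` by adding a point `none` whose closure is everything. -/
def AddGeneric (X : Type u) : Type u := Option X

namespace AddGeneric

variable {X : Type u}

/-- The inclusion of `X` into `AddGeneric X`. -/
def incl (x : X) : AddGeneric X := some x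

/-- The added generic point. -/
def gen : AddGeneric X := none

lemma eq_gen_or_incl (a : AddGeneric X) : a = gen ∨ ∃ x, a = incl x := by
  cases a with
  | none => exact Or.inl rfl
  | some x => exact Or.inr ⟨x, rfl⟩

variable [TopologicalSpace X] [IrreducibleSpace X]

/-- The new point belongs to exactly those open sets that meet `X`. Irreducibility of `X` is what
makes this stable under intersection. -/
instance : TopologicalSpace (AddGeneric X) where
  IsOpen V := IsOpen (incl ⁻¹' V) ∧ (gen ∈ V ↔ (incl ⁻¹' V).Nonempty)
  isOpen_univ := ⟨isOpen_univ, by simp⟩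
  isOpen_inter V W := by
    rintro ⟨hV, hV'⟩ ⟨hW, hW'⟩
    refine ⟨hV.inter hW, ?_⟩
    rw [mem_inter_iff, hV', hW', preimage_inter]
    exact ⟨fun h => nonempty_preirreducible_inter hV hW h.1 h.2,
      fun h => ⟨h.mono inter_subset_left, h.mono inter_subset_right⟩⟩
  isOpen_sUnion S hS := by
    rw [preimage_sUnion]
    refine ⟨isOpen_biUnion fun V hV => (hS V hV).1, ?_⟩
    simp only [mem_sUnion, nonempty_biUnion]
    exact exists_congr fun V => and_congr_right fun hV => (hS V hV).2

lemma isOpen_iff {V : Set (AddGeneric X)} :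
    IsOpen V ↔ IsOpen (incl ⁻¹' V) ∧ (gen ∈ V ↔ (incl ⁻¹' V).Nonempty) := Iff.rfl

lemma isInducing_incl : IsInducing (incl : X → AddGeneric X) := by
  refine isInducing_iff_nhds.2 fun x => le_antisymm ?_ ?_
  · have hcont : Continuous (incl : X → AddGeneric X) :=
      continuous_def.2 fun _ hV => (isOpen_iff.1 hV).1
    exact Filter.map_le_iff_le_comap.1 hcont.continuousAt
  · intro s hs
    obtain ⟨U, hUs, hU, hxU⟩ := mem_nhds_iff.1 hs
    have hpre : incl ⁻¹' (insert gen (incl '' U)) = U := by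
      ext y
      simp only [mem_preimage, mem_insert_iff, mem_image]
      constructor
      · rintro (h | ⟨z, hz, h⟩)
        · exact absurd h (Option.some_ne_none y)
        · exact Option.some_injective _ h ▸ hz
      · exact fun h => Or.inr ⟨y, h, rfl⟩
    refine ⟨insert gen (incl '' U), IsOpen.mem_nhds ?_ (Or.inr ⟨x, hxU, rfl⟩), hpre.trans_subset hUs⟩
    rw [isOpen_iff, hpre]
    exact ⟨hU, fun _ => ⟨x, hxU⟩, fun _ => Or.inl rfl⟩

lemma gen_mem_of_isOpen {V : Set (AddGeneric X)} (hV : IsOpen V) (hne : V.Nonempty) : gen ∈ V := by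
  obtain ⟨a, ha⟩ := hne
  rcases eq_gen_or_incl a with rfl | ⟨x, rfl⟩
  · exact ha
  · exact hV.2.2 ⟨x, ha⟩

lemma gen_specializes (a : AddGeneric X) : gen ⤳ a :=
  specializes_iff_forall_open.2 fun _ hV ha => gen_mem_of_isOpen hV ⟨a, ha⟩

lemma not_isOpen_singleton_gen : ¬ IsOpen ({gen} : Set (AddGeneric X)) := by
  intro h
  obtain ⟨x, hx⟩ := h.2.1 rfl
  exact Option.some_ne_none x hx

lemma not_incl_specializes_gen (hX : ∀ x : X, closure {x} ≠ univ) (x : X) :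
    ¬ (incl x : AddGeneric X) ⤳ gen := by
  intro h
  refine hX x (eq_univ_of_forall fun y => ?_)
  exact specializes_iff_mem_closure.1
    (isInducing_incl.specializes_iff.1 (h.trans (gen_specializes _)))

lemma t0Space [T0Space X] (hX : ∀ x : X, closure {x} ≠ univ) : T0Space (AddGeneric X) := by
  refine ⟨fun a b h => ?_⟩
  rcases eq_gen_or_incl a with rfl | ⟨x, rfl⟩ <;> rcases eq_gen_or_incl b with rfl | ⟨y, rfl⟩
  · rfl
  · exact absurd h.specializes' (not_incl_specializes_gen hX y)
  · exact absurd h.specializes (not_incl_specializes_gen hX x)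
  · exact congrArg incl (isInducing_incl.inseparable_iff.1 h).eq

lemma quasiSober (hX : ∀ C : Set X, IsIrreducible C → IsClosed C → C ≠ univ →
    ∃ x, C = closure {x}) : QuasiSober (AddGeneric X) := by
  refine ⟨fun {C} hirr hC => ?_⟩
  by_cases hg : gen ∈ C
  · refine ⟨gen, (closure_minimal (singleton_subset_iff.2 hg) hC).antisymm fun a _ => ?_⟩
    exact specializes_iff_mem_closure.1 (gen_specializes a)
  · have himg : incl '' (incl ⁻¹' C) = C := by
      refine image_preimage_eq_of_subset fun a ha => ?_
      rcases eq_gen_or_incl a with rfl | ⟨x, rfl⟩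
      · exact absurd ha hg
      · exact ⟨x, rfl⟩
    -- The complement is open and contains the new point, so it meets `X`: the trace of `C` on `X`
    -- is proper.
    obtain ⟨z, hz⟩ := hC.isOpen_compl.2.1 hg
    have hcl : IsClosed (incl ⁻¹' C) := hC.preimage isInducing_incl.continuous
    have hir : IsIrreducible (incl ⁻¹' C : Set X) := by
      refine ⟨?_, fun U V hU hV h₁ h₂ => ?_⟩
      · obtain ⟨a, ha⟩ := hirr.1
        obtain ⟨x, hx, -⟩ := himg.symm ▸ ha
        exact ⟨x, hx⟩
      · obtain ⟨U', hU', rfl⟩ := isInducing_incl.isOpen_iff.1 hU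
        obtain ⟨V', hV', rfl⟩ := isInducing_incl.isOpen_iff.1 hV
        obtain ⟨x, hx, hxU⟩ := h₁
        obtain ⟨y, hy, hyV⟩ := h₂
        obtain ⟨a, ha, haUV⟩ := hirr.2 U' V' hU' hV' ⟨_, hx, hxU⟩ ⟨_, hy, hyV⟩
        obtain ⟨w, hw, rfl⟩ := himg.symm ▸ ha
        exact ⟨w, hw, haUV⟩
    obtain ⟨x, hx⟩ := hX _ hir hcl fun h => hz (h.symm ▸ mem_univ z : z ∈ incl ⁻¹' C)
    have hxC : incl x ∈ C := (hx.symm ▸ subset_closure rfl : x ∈ incl ⁻¹' C)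
    refine ⟨incl x, (closure_minimal (singleton_subset_iff.2 hxC) hC).antisymm fun a ha => ?_⟩
    obtain ⟨w, hw, rfl⟩ := himg.symm ▸ ha
    exact specializes_iff_mem_closure.1
      (isInducing_incl.specializes_iff.2 (specializes_iff_mem_closure.2 (hx ▸ hw)))

/-- The universal property: a map whose range has a generic point of its closure extends uniquely
to the added point. -/
lemma existsUnique_lift {Y : Type u} [TopologicalSpace Y] [T0Space Y] (f : C(X, Y))
    (hf : ∃ y, closure (range f) = closure {y}) :
    ∃! g : C(AddGeneric X, Y), g.comp ⟨incl, isInducing_incl.continuous⟩ = f := by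
  obtain ⟨y, hy⟩ := hf
  have key : ∀ V : Set Y, IsOpen V → (y ∈ V ↔ (f ⁻¹' V).Nonempty) := by
    intro V hV
    constructor
    · intro h
      obtain ⟨_, hz, x, rfl⟩ := mem_closure_iff.1 (hy.symm ▸ subset_closure rfl : y ∈ closure (range f)) V hV h
      exact ⟨x, hz⟩
    · rintro ⟨x, hx⟩
      have hxy : f x ∈ closure {y} := hy ▸ subset_closure ⟨x, rfl⟩
      exact (specializes_iff_mem_closure.2 hxy).mem_open hV hx
  refine ⟨⟨fun a => Option.elim a y f, continuous_def.2 fun V hV => ⟨hV.preimage f.continuous,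
    key V hV⟩⟩, rfl, fun g hg => ?_⟩
  have hgx : ∀ x, g (incl x) = f x := DFunLike.congr_fun hg
  ext a
  rcases eq_gen_or_incl a with rfl | ⟨x, rfl⟩
  · refine Inseparable.eq (inseparable_iff_forall_isOpen.2 fun V hV => ?_)
    refine (hV.preimage g.continuous).2.trans (Iff.trans ?_ (key V hV).symm)
    exact exists_congr fun x => by rw [mem_preimage, mem_preimage, hgx, mem_preimage]
  · exact hgx x

end AddGeneric

/-! ### The Johnstone space -/

/-- The point `(j, k)` of the Johnstone space. -/
def jpt (j : ℕ) (k : WithTop ℕ) : WithScott (ULift.{u} Johnstone) := toScott ⟨⟨j, k⟩⟩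

lemma jpt_surj (x : WithScott (ULift.{u} Johnstone)) : ∃ j k, x = jpt j k := ⟨_, _, rfl⟩

lemma jpt_le_jpt {j m : ℕ} {k n : WithTop ℕ} :
    jpt.{u} j k ≤ jpt m n ↔ (j = m ∧ k ≤ n) ∨ (n = ⊤ ∧ k ≤ (m : WithTop ℕ)) := Iff.rfl

lemma jpt_inj {j m : ℕ} {k n : WithTop ℕ} (h : jpt.{u} j k = jpt m n) : j = m ∧ k = n :=
  ⟨congrArg (fun x => (ULift.down (ofScott x)).fst) h,
    congrArg (fun x => (ULift.down (ofScott x)).snd) h⟩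

instance : PartialOrder (WithScott (ULift.{u} Johnstone)) :=
  inferInstanceAs (PartialOrder (ULift.{u} Johnstone))

lemma jpt_top_maximal {j : ℕ} {x : WithScott (ULift.{u} Johnstone)} (h : jpt j ⊤ ≤ x) :
    x = jpt j ⊤ := by
  obtain ⟨m, n, rfl⟩ := jpt_surj x
  rcases jpt_le_jpt.1 h with ⟨rfl, hn⟩ | ⟨_, hn⟩
  · rw [top_le_iff.1 hn]
  · exact absurd (top_le_iff.1 hn) (WithTop.coe_ne_top)

lemma isLUB_column {j : ℕ} {D : Set (WithScott (ULift.{u} Johnstone))}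
    (hD : ∀ x ∈ D, x ≤ jpt j ⊤) (hj : ∀ k : ℕ, ∃ l : ℕ, k ≤ l ∧ jpt j l ∈ D) :
    IsLUB D (jpt j ⊤) := by
  refine ⟨hD, fun b hb => ?_⟩
  obtain ⟨m, n, rfl⟩ := jpt_surj b
  have hjm : j = m := by
    -- From another column, `(m, ω)` dominates only heights up to `m`.
    obtain ⟨l, hl, hlD⟩ := hj (m + 1)
    rcases jpt_le_jpt.1 (hb hlD) with ⟨h, -⟩ | ⟨-, h⟩
    · exact h
    · have : l ≤ m := WithTop.coe_le_coe.1 h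
      omega
  subst hjm
  refine jpt_le_jpt.2 (Or.inl ⟨rfl, ?_⟩)
  cases n with
  | top => exact le_rfl
  | coe n =>
    obtain ⟨l, hl, hlD⟩ := hj (n + 1)
    rcases jpt_le_jpt.1 (hb hlD) with ⟨-, h⟩ | ⟨h, -⟩
    · have : l ≤ n := WithTop.coe_le_coe.1 h
      omega
    · exact absurd h WithTop.coe_ne_top

/-- A maximal point in `D` must be its greatest element. Otherwise all points of `D` have finite
height; such points are comparable only within a column, so `D` lies in one column, with bounded or
unbounded heights. -/
lemma directed_dichotomy {D : Set (WithScott (ULift.{u} Johnstone))} (hne : D.Nonempty)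
    (hD : DirectedOn (· ≤ ·) D) : (∃ g, IsGreatest D g) ∨
      ∃ j, (∀ x ∈ D, x ≤ jpt j ⊤) ∧ ∀ k : ℕ, ∃ l : ℕ, k ≤ l ∧ jpt j l ∈ D := by
  by_cases htop : ∃ j, jpt j ⊤ ∈ D
  · obtain ⟨j, hj⟩ := htop
    refine Or.inl ⟨_, hj, fun x hx => ?_⟩
    obtain ⟨z, -, h₁, h₂⟩ := hD _ hj x hx
    exact jpt_top_maximal h₁ ▸ h₂
  push Not at htop
  have hfin : ∀ x ∈ D, ∃ (j k : ℕ), x = jpt j k := by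
    intro x hx
    obtain ⟨j, k, rfl⟩ := jpt_surj x
    cases k with
    | top => exact absurd hx (htop j)
    | coe k => exact ⟨j, k, rfl⟩
  obtain ⟨x₀, hx₀⟩ := hne
  obtain ⟨j, k₀, rfl⟩ := hfin x₀ hx₀
  have hcol : ∀ x ∈ D, ∃ k : ℕ, x = jpt j k := by
    intro x hx
    obtain ⟨z, hz, h₁, h₂⟩ := hD _ hx₀ x hx
    obtain ⟨i, k, rfl⟩ := hfin x hx
    obtain ⟨m, n, rfl⟩ := hfin z hz
    rcases jpt_le_jpt.1 h₁ with ⟨rfl, -⟩ | ⟨h, -⟩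
    · rcases jpt_le_jpt.1 h₂ with ⟨rfl, -⟩ | ⟨h, -⟩
      · exact ⟨k, rfl⟩
      · exact absurd h WithTop.coe_ne_top
    · exact absurd h WithTop.coe_ne_top
  by_cases hb : BddAbove {k : ℕ | jpt j k ∈ D}
  · refine Or.inl ⟨_, Nat.sSup_mem ⟨k₀, hx₀⟩ hb, fun x hx => ?_⟩
    obtain ⟨k, rfl⟩ := hcol x hx
    exact jpt_le_jpt.2 (Or.inl ⟨rfl, WithTop.coe_le_coe.2 (le_csSup hb hx)⟩)
  · refine Or.inr ⟨j, fun x hx => ?_, fun k => ?_⟩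
    · obtain ⟨k, rfl⟩ := hcol x hx
      exact jpt_le_jpt.2 (Or.inl ⟨rfl, le_top⟩)
    · obtain ⟨l, hl, hkl⟩ := not_bddAbove_iff.1 hb k
      exact ⟨l, hkl.le, hl⟩

lemma exists_isLUB_of_directedOn {D : Set (WithScott (ULift.{u} Johnstone))} (hne : D.Nonempty)
    (hD : DirectedOn (· ≤ ·) D) : ∃ s, IsLUB D s := by
  rcases directed_dichotomy hne hD with ⟨g, hg⟩ | ⟨j, h₁, h₂⟩
  · exact ⟨g, hg.isLUB⟩
  · exact ⟨_, isLUB_column h₁ h₂⟩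

lemma isOpen_johnstone_iff {U : Set (WithScott (ULift.{u} Johnstone))} :
    IsOpen U ↔ IsUpperSet U ∧ ∀ j, jpt j ⊤ ∈ U → ∃ k : ℕ, jpt j k ∈ U := by
  rw [IsScott.isOpen_iff_isUpperSet_and_dirSupInaccOn (D := univ), dirSupInaccOn_univ]
  refine and_congr_right fun hup => ⟨fun h j hj => ?_, fun h D hne hD a ha haU => ?_⟩
  · obtain ⟨_, ⟨k, rfl⟩, hk⟩ := h (d := range fun k : ℕ => jpt j k) (range_nonempty _) (by
      rintro _ ⟨k, rfl⟩ _ ⟨l, rfl⟩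
      exact ⟨_, ⟨max k l, rfl⟩,
        jpt_le_jpt.2 (Or.inl ⟨rfl, WithTop.coe_le_coe.2 (le_max_left k l)⟩),
        jpt_le_jpt.2 (Or.inl ⟨rfl, WithTop.coe_le_coe.2 (le_max_right k l)⟩)⟩)
      (isLUB_column (by rintro _ ⟨k, rfl⟩; exact jpt_le_jpt.2 (Or.inl ⟨rfl, le_top⟩))
        fun k => ⟨k, le_rfl, k, rfl⟩) hj
    exact ⟨k, hk⟩
  · rcases directed_dichotomy hne hD with ⟨g, hg⟩ | ⟨j, h₁, h₂⟩
    · exact ⟨g, hg.1, hup (ha.2 hg.2) haU⟩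
    · obtain ⟨k, hk⟩ := h j (hup (ha.2 h₁) haU)
      obtain ⟨l, hkl, hl⟩ := h₂ k
      exact ⟨_, hl, hup (jpt_le_jpt.2 (Or.inl ⟨rfl, WithTop.coe_le_coe.2 hkl⟩)) hk⟩

/-- A nonempty open set of the Johnstone space contains almost all maximal points. -/
lemma exists_forall_jpt_top_mem {U : Set (WithScott (ULift.{u} Johnstone))} (hU : IsOpen U)
    (hne : U.Nonempty) : ∃ N : ℕ, ∀ m, N ≤ m → jpt m ⊤ ∈ U := by
  rw [isOpen_johnstone_iff] at hU
  obtain ⟨j, k, hk⟩ : ∃ j k : ℕ, jpt j k ∈ U := by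
    obtain ⟨x, hx⟩ := hne
    obtain ⟨j, k, rfl⟩ := jpt_surj x
    cases k with
    | top => exact ⟨j, hU.2 j hx⟩
    | coe k => exact ⟨j, k, hx⟩
  exact ⟨k, fun m hm => hU.1 (jpt_le_jpt.2 (Or.inr ⟨rfl, WithTop.coe_le_coe.2 hm⟩)) hk⟩

instance : IrreducibleSpace (WithScott (ULift.{u} Johnstone)) where
  isPreirreducible_univ U V hU hV h₁ h₂ := by
    obtain ⟨M, hM⟩ := exists_forall_jpt_top_mem hU (h₁.mono inter_subset_right)
    obtain ⟨N, hN⟩ := exists_forall_jpt_top_mem hV (h₂.mono inter_subset_right)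
    exact ⟨_, mem_univ _, hM _ (le_max_left M N), hN _ (le_max_right M N)⟩
  toNonempty := ⟨jpt 0 0⟩

lemma johnstone_closure_singleton_ne_univ (x : WithScott (ULift.{u} Johnstone)) :
    closure {x} ≠ univ := by
  rw [IsScott.closure_singleton]
  intro h
  have h₀ : x = jpt 0 ⊤ := jpt_top_maximal (h.symm ▸ mem_univ (jpt 0 ⊤) : jpt 0 ⊤ ∈ Iic x)
  have h₁ : x = jpt 1 ⊤ := jpt_top_maximal (h.symm ▸ mem_univ (jpt 1 ⊤) : jpt 1 ⊤ ∈ Iic x)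
  exact absurd (jpt_inj (h₀.symm.trans h₁)).1 zero_ne_one

/-- A tail of a column is relatively open in a closed set missing almost all maximal points outside
the column. -/
lemma isOpen_compl_union_tail {C : Set (WithScott (ULift.{u} Johnstone))} (hC : IsClosed C)
    (j k : ℕ) (h : ∀ m, k ≤ m → m ≠ j → jpt m ⊤ ∉ C) : IsOpen (Cᶜ ∪ Ici (jpt j k)) := by
  have hC' := isOpen_johnstone_iff.1 hC.isOpen_compl
  refine isOpen_johnstone_iff.2 ⟨hC'.1.union (isUpperSet_Ici _), fun i hi => ?_⟩
  by_cases hiC : jpt i ⊤ ∈ C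
  · have hle : jpt.{u} j k ≤ jpt i ⊤ := hi.resolve_left fun h => h hiC
    have hij : j = i := by
      rcases jpt_le_jpt.1 hle with ⟨h, -⟩ | ⟨-, hk⟩
      · exact h
      · by_contra hne
        exact h i (WithTop.coe_le_coe.1 hk) (Ne.symm hne) hiC
    subst hij
    exact ⟨k, Or.inr self_mem_Ici⟩
  · obtain ⟨l, hl⟩ := hC'.2 i hiC
    exact ⟨l, Or.inl hl⟩

/-- A nonempty relatively open subset of an irreducible set is dense in it. -/
lemma eq_closure_singleton_of_isOpen {X : Type u} [TopologicalSpace X] {C U : Set X} {x : X}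
    (hirr : IsIrreducible C) (hC : IsClosed C) (hxC : x ∈ C) (hU : IsOpen U) (hxU : x ∈ U)
    (h : C ∩ U ⊆ closure {x}) : C = closure {x} := by
  refine Subset.antisymm ?_ (closure_minimal (singleton_subset_iff.2 hxC) hC)
  exact (subset_closure_inter_of_isPreirreducible_of_isOpen hirr.2 hU ⟨x, hxC, hxU⟩).trans
    (closure_minimal h isClosed_closure)

/-- Since `C` misses almost all maximal points, some column tail meets `C` in a nonempty relatively
open set lying below a single point of `C`; that point is generic. -/
lemma johnstone_irreducible_closed {C : Set (WithScott (ULift.{u} Johnstone))}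
    (hirr : IsIrreducible C) (hC : IsClosed C) (hne : C ≠ univ) : ∃ x, C = closure {x} := by
  obtain ⟨N, hN⟩ := exists_forall_jpt_top_mem hC.isOpen_compl (nonempty_compl.2 hne)
  have hlow : IsLowerSet C := IsScott.isLowerSet_of_isClosed hC
  by_cases htop : ∃ j, jpt j ⊤ ∈ C
  · obtain ⟨j, hj⟩ := htop
    refine ⟨_, eq_closure_singleton_of_isOpen hirr hC hj
      (isOpen_compl_union_tail hC j N fun m hm _ => hN m hm)
      (Or.inr (jpt_le_jpt.2 (Or.inl ⟨rfl, le_top⟩))) ?_⟩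
    rintro x ⟨hxC, hxU⟩
    have hle : jpt j N ≤ x := hxU.resolve_left fun h => h hxC
    obtain ⟨m, n, rfl⟩ := jpt_surj x
    rw [IsScott.closure_singleton]
    rcases jpt_le_jpt.1 hle with ⟨rfl, -⟩ | ⟨rfl, h⟩
    · exact jpt_le_jpt.2 (Or.inl ⟨rfl, le_top⟩)
    · exact absurd hxC (hN m (WithTop.coe_le_coe.1 h))
  · push Not at htop
    obtain ⟨x, hx⟩ := hirr.1
    obtain ⟨j, k₀, rfl⟩ := jpt_surj x
    cases k₀ with
    | top => exact absurd hx (htop j)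
    | coe k₀ =>
    have hb : BddAbove {k : ℕ | jpt j k ∈ C} := by
      -- The open complement contains `(j, ω)`, the supremum of the column, hence some `(j, B)`.
      obtain ⟨B, hB⟩ := (isOpen_johnstone_iff.1 hC.isOpen_compl).2 j (htop j)
      refine ⟨B, fun k hk => ?_⟩
      by_contra hlt
      exact hB (hlow (jpt_le_jpt.2 (Or.inl ⟨rfl, WithTop.coe_le_coe.2 (not_le.1 hlt).le⟩)) hk)
    refine ⟨_, eq_closure_singleton_of_isOpen hirr hC (Nat.sSup_mem ⟨k₀, hx⟩ hb)
      (isOpen_compl_union_tail hC j _ fun m _ _ => htop m) (Or.inr self_mem_Ici) ?_⟩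
    rintro x ⟨hxC, hxU⟩
    have hle := hxU.resolve_left fun h => h hxC
    obtain ⟨m, n, rfl⟩ := jpt_surj x
    cases n with
    | top => exact absurd hxC (htop m)
    | coe n =>
    rw [IsScott.closure_singleton]
    rcases jpt_le_jpt.1 hle with ⟨rfl, -⟩ | ⟨h, -⟩
    · exact jpt_le_jpt.2 (Or.inl ⟨rfl, WithTop.coe_le_coe.2 (le_csSup hb hxC)⟩)
    · exact absurd h WithTop.coe_ne_top

/-! ### Maps from the Johnstone space to well-filtered spaces -/

/-- Any member of the cover containing one of the points already contains all but finitely many. -/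
lemma isCompact_johnstone_tail (n : ℕ) :
    IsCompact ((fun m => jpt.{u} m ⊤) '' Ici n) := by
  rw [isCompact_iff_finite_subcover]
  intro ι U hU hsub
  obtain ⟨i, hi⟩ := mem_iUnion.1 (hsub ⟨n, le_refl n, rfl⟩)
  obtain ⟨N, hN⟩ := exists_forall_jpt_top_mem (hU i) ⟨_, hi⟩
  have hfin : ∀ m : ℕ, n ≤ m → ∃ i, jpt m ⊤ ∈ U i := fun m hm =>
    mem_iUnion.1 (hsub ⟨m, hm, rfl⟩)
  classical
  have : Nonempty ι := ⟨i⟩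
  choose! c hc using hfin
  refine ⟨insert i ((Finset.range N).image c), ?_⟩
  rintro _ ⟨m, hm, rfl⟩
  rcases le_or_gt N m with h | h
  · exact mem_biUnion (Finset.mem_insert_self _ _) (hN m h)
  · exact mem_biUnion (Finset.mem_insert_of_mem (Finset.mem_image_of_mem c (Finset.mem_range.2 h)))
      (hc m hm)

lemma subset_saturation {Y : Type u} [TopologicalSpace Y] (A : Set Y) :
    A ⊆ ⋂₀ {U : Set Y | IsOpen U ∧ A ⊆ U} := fun _ ha _ hU => hU.2 ha

lemma isSaturated_saturation {Y : Type u} [TopologicalSpace Y] (A : Set Y) :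
    IsSaturated (⋂₀ {U : Set Y | IsOpen U ∧ A ⊆ U}) :=
  (subset_saturation _).antisymm fun _ hy _ hU =>
    hy _ ⟨hU.1, fun _ hz => hz _ hU⟩

lemma isCompact_saturation {Y : Type u} [TopologicalSpace Y] {A : Set Y} (hA : IsCompact A) :
    IsCompact (⋂₀ {U : Set Y | IsOpen U ∧ A ⊆ U}) := by
  rw [isCompact_iff_finite_subcover]
  intro ι U hU hsub
  obtain ⟨t, ht⟩ := hA.elim_finite_subcover U hU ((subset_saturation A).trans hsub)
  exact ⟨t, fun y hy => hy _ ⟨isOpen_biUnion fun i _ => hU i, ht⟩⟩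

lemma exists_mem_closure_of_mem_saturation {Y : Type u} [TopologicalSpace Y] {A : Set Y} {y : Y}
    (hy : y ∈ ⋂₀ {U : Set Y | IsOpen U ∧ A ⊆ U}) : ∃ a ∈ A, a ∈ closure {y} := by
  by_contra! h
  exact hy (closure {y})ᶜ ⟨isClosed_closure.isOpen_compl, h⟩ (subset_closure rfl)

/-- Well-filteredness, applied to the saturated images of the tails, gives a point `y` of the
closure of the range lying in all of them. Each tail then has a point mapped into `closure {y}`. A
value outside `closure {y}` would force almost all maximal points to be mapped outside as well. -/
lemma exists_closure_range_eq {Y : Type u} [TopologicalSpace Y] (hY : IsWellFiltered Y)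
    (f : C(WithScott (ULift.{u} Johnstone), Y)) : ∃ y, closure (range f) = closure {y} := by
  let A : ℕ → Set Y := fun n => f '' ((fun m => jpt m ⊤) '' Ici n)
  let S : ℕ → Set Y := fun n => ⋂₀ {U : Set Y | IsOpen U ∧ A n ⊆ U}
  have hAne : ∀ n, f (jpt n ⊤) ∈ A n := fun n => ⟨_, ⟨n, le_refl n, rfl⟩, rfl⟩
  have hmono : ∀ m n, m ≤ n → S n ⊆ S m := fun m n hmn y hy U hU =>
    hy U ⟨hU.1, (image_mono (image_mono (Ici_subset_Ici.2 hmn))).trans hU.2⟩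
  obtain ⟨y, hyS, hyC⟩ : (⋂₀ range S ∩ closure (range f)).Nonempty := by
    by_contra hem
    obtain ⟨_, ⟨n, rfl⟩, hn⟩ := hY (range S) (range_nonempty S) (by
        rintro _ ⟨n, rfl⟩
        exact ⟨⟨_, subset_saturation _ (hAne n)⟩,
          isCompact_saturation ((isCompact_johnstone_tail n).image f.continuous),
          isSaturated_saturation _⟩) (by
        rintro _ ⟨m, rfl⟩ _ ⟨n, rfl⟩
        exact ⟨_, ⟨max m n, rfl⟩, hmono _ _ (le_max_left m n), hmono _ _ (le_max_right m n)⟩)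
      _ isClosed_closure.isOpen_compl fun y hy hyC => hem ⟨y, hy, hyC⟩
    exact hn (subset_saturation _ (hAne n)) (subset_closure ⟨_, rfl⟩)
  refine ⟨y, Subset.antisymm (closure_minimal ?_ isClosed_closure)
    (closure_minimal (singleton_subset_iff.2 hyC) isClosed_closure)⟩
  rintro _ ⟨x, rfl⟩
  by_contra hx
  obtain ⟨N, hN⟩ := exists_forall_jpt_top_mem
    (isClosed_closure.isOpen_compl.preimage f.continuous) ⟨x, hx⟩
  obtain ⟨_, ⟨_, ⟨m, hm, rfl⟩, rfl⟩, h⟩ :=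
    exists_mem_closure_of_mem_saturation (mem_sInter.1 hyS _ ⟨N, rfl⟩)
  exact hN m hm h

/-! ### The reflection of the Johnstone space -/

lemma sob_addGeneric_johnstone :
    Sob (TopCat.of (AddGeneric (WithScott (ULift.{u} Johnstone)))) :=
  ⟨AddGeneric.t0Space johnstone_closure_singleton_ne_univ,
    AddGeneric.quasiSober fun _ => johnstone_irreducible_closed⟩

/-- The inclusion of the Johnstone space into the space with an added generic point. -/
def johnstoneUnit :
    C(johnstoneSpace.{u}, TopCat.of (AddGeneric (WithScott (ULift.{u} Johnstone)))) :=
  ⟨AddGeneric.incl,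
    (AddGeneric.isInducing_incl (X := WithScott (ULift.{u} Johnstone))).continuous⟩

lemma isReflection_johnstoneUnit {K : ObjectProperty TopCat.{u}} (hK : K ≤ TopW) (hS : Sob ≤ K) :
    IsReflection K johnstoneSpace _ johnstoneUnit where
  mem := hS _ sob_addGeneric_johnstone
  existsUnique_lift Y hY f := by
    have := (hK Y hY).1
    have key : ∀ f : C(WithScott (ULift.{u} Johnstone), Y),
        ∃! g : C(AddGeneric (WithScott (ULift.{u} Johnstone)), Y),
          g.comp ⟨AddGeneric.incl, AddGeneric.isInducing_incl.continuous⟩ = f := fun f =>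
      AddGeneric.existsUnique_lift f (exists_closure_range_eq (hK Y hY).2 f)
    exact key f

lemma not_isScottSpace_addGeneric_johnstone :
    ¬ IsScottSpace (TopCat.of (AddGeneric (WithScott (ULift.{u} Johnstone)))) := by
  rintro ⟨P, _, ⟨h⟩⟩
  change AddGeneric (WithScott (ULift.{u} Johnstone)) ≃ₜ WithScott P at h
  have hle : ∀ {a b}, h a ≤ h b ↔ b ⤳ a := by
    intro a b
    rw [← h.isInducing.specializes_iff, specializes_iff_mem_closure, IsScott.closure_singleton,
      mem_Iic]
  have htop : ∀ p, p ≤ h AddGeneric.gen := by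
    intro p
    obtain ⟨a, rfl⟩ := h.surjective p
    exact hle.2 (AddGeneric.gen_specializes a)
  have hanti : ∀ p : WithScott P, h AddGeneric.gen ≤ p → p = h AddGeneric.gen := fun p hp =>
    le_antisymm (α := P) (htop p) hp
  suffices hop : IsOpen ({h AddGeneric.gen} : Set (WithScott P)) by
    refine AddGeneric.not_isOpen_singleton_gen (X := WithScott (ULift.{u} Johnstone)) ?_
    convert hop.preimage h.continuous
    ext a
    simp
  rw [IsScott.isOpen_iff_isUpperSet_and_dirSupInaccOn (D := univ), dirSupInaccOn_univ]
  refine ⟨fun p q hpq hp => hanti q (mem_singleton_iff.1 hp ▸ hpq), fun D hne hD a ha haU => ?_⟩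
  rw [mem_singleton_iff] at haU
  subst haU
  by_contra hem
  have hincl : ∀ p ∈ D, ∃ x, p = h (AddGeneric.incl x) := by
    intro p hp
    obtain ⟨a, rfl⟩ := h.surjective p
    rcases AddGeneric.eq_gen_or_incl a with rfl | ⟨x, rfl⟩
    · exact absurd ⟨_, hp, rfl⟩ hem
    · exact ⟨x, rfl⟩
  have hle' : ∀ {x y : WithScott (ULift.{u} Johnstone)},
      h (AddGeneric.incl x) ≤ h (AddGeneric.incl y) ↔ x ≤ y := by
    intro x y
    rw [hle, AddGeneric.isInducing_incl.specializes_iff, specializes_iff_mem_closure,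
      IsScott.closure_singleton, mem_Iic]
  -- `D` avoids the new point, so it is a directed subset of J and has a supremum `s` there; `s` is
  -- then an upper bound of `D` strictly below the new point.
  obtain ⟨s, hs⟩ := exists_isLUB_of_directedOn
    (D := {x : WithScott (ULift.{u} Johnstone) | h (AddGeneric.incl x) ∈ D}) (by
      obtain ⟨p, hp⟩ := hne
      obtain ⟨x, rfl⟩ := hincl p hp
      exact ⟨x, hp⟩) (by
      intro x hx y hy
      obtain ⟨r, hr, h₁, h₂⟩ := hD _ hx _ hy
      obtain ⟨z, rfl⟩ := hincl r hr
      exact ⟨z, hr, hle'.1 h₁, hle'.1 h₂⟩)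
  have hub : h (AddGeneric.incl s) ∈ upperBounds D := by
    intro p hp
    obtain ⟨x, rfl⟩ := hincl p hp
    exact hle'.2 (hs.1 hp)
  exact AddGeneric.not_incl_specializes_gen johnstone_closure_singleton_ne_univ s
    (hle.1 (ha.2 hub))

lemma reflectionNotScott_johnstoneSpace {K : ObjectProperty TopCat.{u}} (hK : K ≤ TopW)
    (hS : Sob ≤ K) : ReflectionNotScott K johnstoneSpace := by
  refine ⟨⟨_, _, isReflection_johnstoneUnit hK hS⟩, fun R η hR => ?_⟩
  rintro ⟨P, hP, ⟨e⟩⟩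
  obtain ⟨e'⟩ := (isReflection_johnstoneUnit hK hS).nonempty_homeomorph hR
  exact not_isScottSpace_addGeneric_johnstone ⟨P, hP, ⟨e'.trans e⟩⟩

end KRefl

theorem mainTheorem3 :
    (∀ K : ObjectProperty TopCat.{u},
      K ≤ TopW → Sob ≤ K → K.IsClosedUnderIsomorphisms → IsAdequate K →
        ReflectionNotScott K johnstoneSpace) ∧
    ReflectionNotScott Sob.{u} johnstoneSpace ∧
    ReflectionNotScott TopW.{u} johnstoneSpace :=
  ⟨fun _ hK hS _ _ => reflectionNotScott_johnstoneSpace hK hS,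
    reflectionNotScott_johnstoneSpace sob_le_topW le_rfl,
    reflectionNotScott_johnstoneSpace le_rfl sob_le_topW⟩
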